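/- For $\operatorname{Im}\tau>0$ let $\eta(\tau)=e^{2\pi i\tau/24}\prod_{n\ge1}(1-e^{2\pi i n\tau})$ be the Dedekind eta function, let $\zeta_n=e^{2\pi i/n}$, and let $A=\begin{pmatrix}2&-1\\-1&2\end{pmatrix}$ be the Cartan matrix of type $A_2$. For a weight with integer Dynkin labels $\beta\in\mathbb Z^2$ define the level $3$ theta function $$\theta^{\beta}(\tau)=\sum_{m\in\mathbb Z^2} e^{2\pi i\tau\cdot\frac32\,{}^t(m+\frac13A^{-1}\beta)\,A\,(m+\frac13A^{-1}\beta)} .$$ It depends only on the class of $\beta$ in $M^*/3M$, where $M^*=\mathbb Z^2$ is the weight lattice and $M=A\mathbb Z^2$ the root lattice. Put $\lambda_0=(0,0)$ and $\lambda_1^k=k(1,0)$. For integers $a,d>0$ and $0\le b<d$ with $ad=3$ let $$\Theta^{d,b}(\tau)=\frac{\eta(\tau)^3}{\eta\left(\frac{a\tau+b}{d}\right)},$$ and define $$\tilde\Theta^{1,0}=\theta^{\lambda_0}-\theta^{\lambda_1^3},\qquad \tilde\Theta^{3,b}=\zeta_{24}^{-3b}\zeta_9^{b}\left(\theta^{\lambda_1^1}+\zeta_3^{b}\theta^{\lambda_1^2}+\zeta_3^{2b}\theta^{\lambda_1^4}\right)\quad(b=0,1,2).$$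 Then, for all $\tau$ with $\operatorname{Im}\tau>0$: 1. $\Theta^{1,0}(\tau)=\tilde\Theta^{1,0}(\tau)$, and $\Theta^{3,b}(\tau)=\tilde\Theta^{3,b}(\tau)$ for $b=0,1,2$. 2. $\tilde\Theta^{1,0}(-1/\tau)=(-i\tau)\sqrt3\,\tilde\Theta^{3,0}(\tau)$ and $\tilde\Theta^{3,1}(-1/\tau)=(-i\tau)\,\zeta_{24}\,\tilde\Theta^{3,2}(\tau)$, and the same two identities hold with every $\tilde\Theta$ replaced by $\Theta$. 3. Consequently, for all $a,d,b$ as above there are integers $n_\beta$, $k_1(\beta)$, $k_2(\beta)$ for $\beta\in M^*/3M$, independent of $\tau$, such that $$\Theta^{d,b}(\tau)=\sum_{\beta\in M^*/3M} n_\beta\,\zeta_{24}^{k_1(\beta)}\,\zeta_{9}^{k_2(\beta)}\,\theta^{\beta}(\tau).$$ -/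

import Mathlib

open Complex

noncomputable section

namespace A2Blowup

/-- The root of unity `ζ_n = exp(2πi/n)`. -/
def zeta (n : ℕ) : ℂ := cexp (2 * (Real.pi : ℂ) * I / (n : ℂ))

/-- The vector `m + (1/l) C⁻¹ β`, for an integer matrix `C` (the Cartan matrix of a simply laced
root system) and a weight `β` given by its integer Dynkin labels. -/
def shiftedVector {r : ℕ} (C : Matrix (Fin r) (Fin r) ℤ) (l : ℕ) (β m : Fin r → ℤ) :
    Fin r → ℝ :=
  (fun i => (m i : ℝ)) +
    (1 / (l : ℝ)) • Matrix.mulVec (C.map (fun n : ℤ => (n : ℝ)))⁻¹ (fun i => (β i : ℝ))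

/-- The level `l` theta function of the Cartan matrix `C` with weight vector `β`,
`θ^β(τ) = ∑_{m ∈ ℤ^r} q^{(l/2) ᵗ(m + C⁻¹β/l) C (m + C⁻¹β/l)}`, where `q^x = exp(2πiτx)`. -/
def levelTheta {r : ℕ} (C : Matrix (Fin r) (Fin r) ℤ) (l : ℕ) (β : Fin r → ℤ) (τ : ℂ) : ℂ :=
  ∑' m : Fin r → ℤ,
    cexp (2 * (Real.pi : ℂ) * I * τ *
      (((l : ℝ) / 2 * dotProduct (shiftedVector C l β m)
        (Matrix.mulVec (C.map (fun n : ℤ => (n : ℝ))) (shiftedVector C l β m)) : ℝ) : ℂ))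

/-- The level `3` theta functions of type `A₂`. -/
def thetaA2 (β : Fin 2 → ℤ) (τ : ℂ) : ℂ := levelTheta (CartanMatrix.A 2) 3 β τ

/-- The weight `λ₀ = (0, 0)`. -/
def lam0 : Fin 2 → ℤ := ![0, 0]

/-- The weights `λ₁^k = k (1, 0)`. -/
def lam1 (k : ℤ) : Fin 2 → ℤ := k • ![1, 0]

/-- The eta quotient `Θ^{d,b}(τ) = η(τ)^3 / η((aτ + b)/d)` (to be used with `a d = 3`). -/
def Theta (a d b : ℕ) (τ : ℂ) : ℂ :=
  ModularForm.eta τ ^ 3 / ModularForm.eta (((a : ℂ) * τ + (b : ℂ)) / (d : ℂ))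

/-- The theta combination `θ^{λ₀} - θ^{λ₁^3}`. -/
def candOne (τ : ℂ) : ℂ := thetaA2 lam0 τ - thetaA2 (lam1 3) τ

/-- The theta combinations
`ζ_24^{-3b} ζ_9^b (θ^{λ₁^1} + ζ_3^b θ^{λ₁^2} + ζ_3^{2b} θ^{λ₁^4})`. -/
def candThree (b : ℕ) (τ : ℂ) : ℂ :=
  zeta 24 ^ (-3 * (b : ℤ)) * zeta 9 ^ b *
    (thetaA2 (lam1 1) τ + zeta 3 ^ b * thetaA2 (lam1 2) τ + zeta 3 ^ (2 * b) * thetaA2 (lam1 4) τ)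

/-- The sublattice `3M` of the weight lattice `M* = ℤ²` of `A₂`, in Dynkin labels: the root lattice
`M` consists of the vectors `A m` with `m ∈ ℤ²`, where `A` is the Cartan matrix. -/
def threeRootLattice : Submodule ℤ (Fin 2 → ℤ) :=
  LinearMap.range (Matrix.mulVecLin ((3 : ℤ) • CartanMatrix.A 2))

lemma map_A2_det_ne_zero :
    ((CartanMatrix.A 2).map (fun n : ℤ => (n : ℝ))).det ≠ 0 := by
  simp [Matrix.det_fin_two, CartanMatrix.A]
  norm_num

lemma shiftedVector_add (β x m : Fin 2 → ℤ) :
    shiftedVector (CartanMatrix.A 2) 3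
      (β + Matrix.mulVecLin ((3 : ℤ) • CartanMatrix.A 2) x) m =
    shiftedVector (CartanMatrix.A 2) 3 β (m + x) := by
  have h : (fun i => ((β + Matrix.mulVecLin ((3 : ℤ) • CartanMatrix.A 2) x) i : ℝ)) =
      (fun i => (β i : ℝ)) +
      (3 : ℝ) • Matrix.mulVec ((CartanMatrix.A 2).map (fun n : ℤ => (n : ℝ)))
        (fun i => (x i : ℝ)) := by
    funext i
    fin_cases i <;>
      simp [CartanMatrix.A] <;> ring
  unfold shiftedVector
  rw [h, Matrix.mulVec_add, Matrix.mulVec_smul, Matrix.mulVec_mulVec,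
    Matrix.nonsing_inv_mul _ (isUnit_iff_ne_zero.mpr map_A2_det_ne_zero), Matrix.one_mulVec]
  have h3 : (1 / ((3 : ℕ) : ℝ)) * 3 = 1 := by norm_num
  rw [smul_add, smul_smul, h3, one_smul]
  funext i
  simp only [Pi.add_apply, Int.cast_add]
  ring

lemma thetaA2_eq_of_sub_mem {β γ : Fin 2 → ℤ} (h : β - γ ∈ threeRootLattice) :
    thetaA2 β = thetaA2 γ := by
  obtain ⟨x, hx⟩ := h
  have hβ : β = γ + Matrix.mulVecLin ((3 : ℤ) • CartanMatrix.A 2) x := by rw [hx]; abel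
  funext τ
  unfold thetaA2 levelTheta
  rw [hβ]
  simp_rw [shiftedVector_add]
  exact (Equiv.addRight x).tsum_eq (fun m : Fin 2 → ℤ =>
    cexp (2 * (Real.pi : ℂ) * I * τ *
      ((((3 : ℕ) : ℝ) / 2 * dotProduct (shiftedVector (CartanMatrix.A 2) 3 γ m)
        (Matrix.mulVec ((CartanMatrix.A 2).map (fun n : ℤ => (n : ℝ)))
          (shiftedVector (CartanMatrix.A 2) 3 γ m)) : ℝ) : ℂ)))

/-- `θ^β` for a class `β ∈ M*/3M`. -/
def thetaA2Class (β : (Fin 2 → ℤ) ⧸ threeRootLattice) : ℂ → ℂ :=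
  Quotient.liftOn' β thetaA2 fun _ _ h =>
    thetaA2_eq_of_sub_mem ((Submodule.quotientRel_def threeRootLattice).mp h)

end A2Blowup

end

/-! Put `q = exp(2πiτ)` and let `E(q)` be Euler's product. The identities at `b = 0` amount to
expanding `E(q)^3 / E(q^3)` and `E(q^3)^3 / E(q)` as theta series of the `A₂` lattice. By the Jacobi
triple product, multiplying three thetas in `z` shifted by thirds gives `E(q)^3 / E(q^3)` times
`jacobiTheta₂ (3z) (3τ)` (`jacobiTheta₂_mul_thirds`). Dually, three thetas of modulus `3τ` shifted
by `-τ, 0, τ` give `E(q^3)^3 / E(q)` times `jacobiTheta₂ z τ` (`jacobiTheta₂_mul_shifts`).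

Now compare constant terms in `z`. A single theta has constant term 1; a product of three has a sum
over integer triples with sum zero, which is the `A₂` lattice. Splitting that lattice into three
classes modulo 3 turns the sums into the level 3 theta functions (`tsum_thirds_eq_candOne`,
`tsum_shifts_eq_theta`). The cases `b > 0` follow from `τ ↦ τ + b`, under which both sides acquire
explicit roots of unity.

The inversion formulas are proved for the eta quotients, from the law of `η` under `-1/τ`, and
carried to the theta combinations by the identities just obtained. No Poisson summation on the
lattice is needed. -/

/-! ### The q-binomial theorem and the Jacobi triple product. -/

section JacobiTripleProduct

open Filter Topology Finset

/-- The finite product `∏_{k=1}^{n} (1 - q^k)`. -/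
noncomputable def qFactorialProd (q : ℂ) (n : ℕ) : ℂ := ∏ k ∈ range n, (1 - q ^ (k + 1))

lemma one_sub_pow_succ_ne_zero {q : ℂ} (hq : ‖q‖ < 1) (n : ℕ) : 1 - q ^ (n + 1) ≠ 0 := by
  intro h
  have h1 : ‖q‖ ^ (n + 1) < 1 := pow_lt_one₀ (norm_nonneg _) hq (by omega)
  rw [← norm_pow, ← sub_eq_zero.mp h] at h1
  simp at h1

lemma qFactorialProd_ne_zero {q : ℂ} (hq : ‖q‖ < 1) (n : ℕ) : qFactorialProd q n ≠ 0 :=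
  prod_ne_zero_iff.mpr fun k _ => one_sub_pow_succ_ne_zero hq k

lemma tprod_one_sub_pow_succ_ne_zero {q : ℂ} (hq : ‖q‖ < 1) :
    ∏' n : ℕ, (1 - q ^ (n + 1)) ≠ 0 := by
  refine tprod_one_add_ne_zero_of_summable (f := fun n : ℕ => -q ^ (n + 1)) (fun i => ?_) ?_
  · simpa [← sub_eq_add_neg] using one_sub_pow_succ_ne_zero hq i
  · simpa using (summable_nat_add_iff 1).mpr (summable_geometric_of_lt_one (norm_nonneg _) hq)

lemma tendsto_qFactorialProd {q : ℂ} (hq : ‖q‖ < 1) :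
    Tendsto (qFactorialProd q) atTop (𝓝 (∏' n : ℕ, (1 - q ^ (n + 1)))) :=
  (ModularForm.multipliable_one_sub_pow hq).hasProd.tendsto_prod_nat

/-- The Gaussian binomial coefficient, for `k ≤ n`. -/
noncomputable def gaussBinom (q : ℂ) (n k : ℕ) : ℂ :=
  qFactorialProd q n / (qFactorialProd q k * qFactorialProd q (n - k))

lemma gaussBinom_zero_right {q : ℂ} (hq : ‖q‖ < 1) (n : ℕ) : gaussBinom q n 0 = 1 := by
  have h0 : qFactorialProd q 0 = 1 := rfl
  rw [gaussBinom, h0, one_mul, Nat.sub_zero]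
  exact div_self (qFactorialProd_ne_zero hq n)

lemma gaussBinom_self {q : ℂ} (hq : ‖q‖ < 1) (n : ℕ) : gaussBinom q n n = 1 := by
  have h0 : qFactorialProd q 0 = 1 := rfl
  rw [gaussBinom, Nat.sub_self, h0, mul_one]
  exact div_self (qFactorialProd_ne_zero hq n)

lemma gaussBinom_succ_succ {q : ℂ} (hq : ‖q‖ < 1) {n k : ℕ} (hk : k < n) :
    gaussBinom q (n + 1) (k + 1) =
      q ^ (k + 1) * gaussBinom q n (k + 1) + gaussBinom q n k := by
  obtain ⟨m, rfl⟩ : ∃ m, n = k + 1 + m := ⟨n - (k + 1), by omega⟩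
  have hs : ∀ i, qFactorialProd q (i + 1) = qFactorialProd q i * (1 - q ^ (i + 1)) := fun i =>
    prod_range_succ _ _
  have e1 : k + 1 + m + 1 - (k + 1) = m + 1 := by omega
  have e2 : k + 1 + m - (k + 1) = m := by omega
  have e3 : k + 1 + m - k = m + 1 := by omega
  simp only [gaussBinom, e1, e2, e3]
  rw [hs (k + 1 + m), hs k, hs m]
  have h1 := qFactorialProd_ne_zero hq k
  have h2 := qFactorialProd_ne_zero hq m
  have h3 := one_sub_pow_succ_ne_zero hq k
  have h4 := one_sub_pow_succ_ne_zero hq m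
  field_simp
  ring

/-- The `q`-binomial theorem. -/
lemma prod_one_add_mul_pow_eq_sum {q : ℂ} (hq : ‖q‖ < 1) (n : ℕ) (x : ℂ) :
    ∏ k ∈ range n, (1 + x * q ^ k) =
      ∑ k ∈ range (n + 1), gaussBinom q n k * q ^ (k.choose 2) * x ^ k := by
  induction n generalizing x with
  | zero => simp [gaussBinom_self hq]
  | succ n ih =>
    -- Splitting off the factor `k = 0` leaves the product of length `n` at `x * q`; the q-Pascal
    -- rule then matches coefficients.
    have h1 : ∏ k ∈ range (n + 1), (1 + x * q ^ k) =
        (1 + x) * ∏ k ∈ range n, (1 + x * q * q ^ k) := by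
      rw [prod_range_succ']
      simp only [pow_zero, mul_one, pow_succ']
      rw [mul_comm]
      simp only [mul_assoc]
    have hc : ∀ k : ℕ, (k + 1).choose 2 = k.choose 2 + k := fun k => by
      rw [Nat.choose_succ_succ' k 1, Nat.choose_one_right, add_comm]
    set F : ℕ → ℂ := fun k => gaussBinom q n k * q ^ (k.choose 2) * (x * q) ^ k with hF
    have hF1 : ∑ k ∈ range (n + 1), F k = ∑ k ∈ range n, F (k + 1) + F 0 := sum_range_succ' _ _
    have hF2 : ∑ k ∈ range (n + 1), F k = ∑ k ∈ range n, F k + F n := sum_range_succ _ _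
    have hF3 : (1 + x) * ∑ k ∈ range (n + 1), F k =
        ∑ k ∈ range n, F (k + 1) + F 0 + (∑ k ∈ range n, x * F k + x * F n) := by
      rw [add_mul, one_mul, ← hF1, hF2, mul_add, mul_sum]
    rw [h1, ih, hF3, sum_range_succ' _ (n + 1), sum_range_succ _ n]
    have h2 : ∀ k ∈ range n, gaussBinom q (n + 1) (k + 1) * q ^ ((k + 1).choose 2) * x ^ (k + 1) =
        gaussBinom q n (k + 1) * q ^ ((k + 1).choose 2) * (x * q) ^ (k + 1) +
        x * (gaussBinom q n k * q ^ (k.choose 2) * (x * q) ^ k) := by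
      intro k hk
      rw [gaussBinom_succ_succ hq (mem_range.mp hk), hc]
      ring
    rw [sum_congr rfl h2, sum_add_distrib, hF]
    simp only [gaussBinom_zero_right hq, gaussBinom_self hq, hc]
    ring

/-- The factor `∏_{n ≥ 0} (1 + h^{2n+1} w)` of the Jacobi triple product. -/
noncomputable def oddProd (h w : ℂ) : ℂ := ∏' n : ℕ, (1 + h ^ (2 * n + 1) * w)

lemma multipliable_oddProd {h : ℂ} (hh : ‖h‖ < 1) (w : ℂ) :
    Multipliable fun n : ℕ => 1 + h ^ (2 * n + 1) * w := by
  refine multipliable_one_add_of_summable ?_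
  simp only [norm_mul, norm_pow]
  refine Summable.mul_right _ ?_
  have : (fun n : ℕ => ‖h‖ ^ (2 * n + 1)) = fun n : ℕ => ‖h‖ * (‖h‖ ^ 2) ^ n := by
    ext n; rw [← pow_mul]; ring
  rw [this]
  exact (summable_geometric_of_lt_one (by positivity)
    (pow_lt_one₀ (norm_nonneg _) hh two_ne_zero)).mul_left _

lemma tendsto_oddProd {h : ℂ} (hh : ‖h‖ < 1) (w : ℂ) :
    Tendsto (fun N : ℕ => ∏ k ∈ range N, (1 + h ^ (2 * k + 1) * w)) atTop (𝓝 (oddProd h w)) :=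
  (multipliable_oddProd hh w).hasProd.tendsto_prod_nat

/-- The finite form of the Jacobi triple product. -/
lemma finite_triple_product {h w : ℂ} (h0 : h ≠ 0) (hh : ‖h‖ < 1) (hw : w ≠ 0) (N : ℕ) :
    (∏ k ∈ range N, (1 + h ^ (2 * k + 1) * w)) * ∏ k ∈ range N, (1 + h ^ (2 * k + 1) * w⁻¹) =
      ∑ j ∈ Icc (-(N : ℤ)) N,
        gaussBinom (h ^ 2) (2 * N) (N + j).toNat * (h ^ (j ^ 2) * w ^ j) := by
  have hq : ‖h ^ 2‖ < 1 := by rw [norm_pow]; exact pow_lt_one₀ (norm_nonneg _) hh two_ne_zero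
  have hC : w ^ N * h ^ (-(N : ℤ) ^ 2) ≠ 0 := mul_ne_zero (pow_ne_zero _ hw) (zpow_ne_zero _ h0)
  refine mul_left_cancel₀ hC ?_
  -- With this argument the exponents of `h` run over the odd numbers from `1 - 2N` to `2N - 1`.
  -- Each negative one contributes a monomial `w h^{-(2k+1)}` times a factor in `w⁻¹`; since the
  -- first `N` odd numbers sum to `N²`, the monomials multiply to `w^N h^{-N²}`.
  have key := prod_one_add_mul_pow_eq_sum hq (2 * N) (w * h ^ (1 - 2 * (N : ℤ)))
  have hL : ∏ k ∈ range (2 * N), (1 + w * h ^ (1 - 2 * (N : ℤ)) * (h ^ 2) ^ k) =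
      w ^ N * h ^ (-(N : ℤ) ^ 2) * ((∏ k ∈ range N, (1 + h ^ (2 * k + 1) * w)) *
        ∏ k ∈ range N, (1 + h ^ (2 * k + 1) * w⁻¹)) := by
    have hA : ∀ k : ℕ, 1 + w * h ^ (1 - 2 * (N : ℤ)) * (h ^ 2) ^ (N + k) =
        1 + h ^ (2 * k + 1) * w := by
      intro k
      have : h ^ (1 - 2 * (N : ℤ)) * (h ^ 2) ^ (N + k) = h ^ (2 * k + 1) := by
        rw [← pow_mul, ← zpow_natCast h (2 * (N + k)), ← zpow_add₀ h0,
          ← zpow_natCast h (2 * k + 1)]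
        congr 1; push_cast; ring
      rw [mul_assoc, this, mul_comm]
    have hB : ∏ k ∈ range N, (1 + w * h ^ (1 - 2 * (N : ℤ)) * (h ^ 2) ^ k) =
        w ^ N * h ^ (-(N : ℤ) ^ 2) * ∏ k ∈ range N, (1 + h ^ (2 * k + 1) * w⁻¹) := by
      rw [← prod_range_reflect]
      have h1 : ∀ k ∈ range N, 1 + w * h ^ (1 - 2 * (N : ℤ)) * (h ^ 2) ^ (N - 1 - k) =
          w * h ^ (-(2 * (k : ℤ) + 1)) * (1 + h ^ (2 * k + 1) * w⁻¹) := by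
        intro k hk
        have hk := mem_range.mp hk
        have e1 : h ^ (1 - 2 * (N : ℤ)) * (h ^ 2) ^ (N - 1 - k) = h ^ (-(2 * (k : ℤ) + 1)) := by
          rw [← pow_mul, ← zpow_natCast h (2 * (N - 1 - k)), ← zpow_add₀ h0]
          congr 1
          have : ((N - 1 - k : ℕ) : ℤ) = N - 1 - k := by omega
          push_cast [this]; ring
        have e2 : h ^ (-(2 * (k : ℤ) + 1)) * h ^ (2 * k + 1) = 1 := by
          rw [← zpow_natCast h (2 * k + 1), ← zpow_add₀ h0]
          simp
        rw [mul_assoc w, e1]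
        calc 1 + w * h ^ (-(2 * (k : ℤ) + 1))
            = w * h ^ (-(2 * (k : ℤ) + 1)) + (h ^ (-(2 * (k : ℤ) + 1)) * h ^ (2 * k + 1)) *
              (w * w⁻¹) := by rw [e2, mul_inv_cancel₀ hw]; ring
          _ = _ := by ring
      rw [prod_congr rfl h1, prod_mul_distrib, prod_mul_distrib, prod_const, card_range]
      congr 2
      clear hA key hC h1
      induction N with
      | zero => simp
      | succ n ih =>
        rw [prod_range_succ, ih, ← zpow_add₀ h0]
        congr 1; push_cast; ring
    rw [two_mul, prod_range_add, prod_congr rfl fun k _ => hA k, hB]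
    ring
  rw [← hL, key, mul_sum]
  symm
  refine sum_bij (fun j _ => ((N : ℤ) + j).toNat) ?_ ?_ ?_ ?_
  · intro j hj
    rw [mem_Icc] at hj
    rw [mem_range]; omega
  · intro i hi j hj hij
    rw [mem_Icc] at hi hj
    omega
  · intro k hk
    rw [mem_range] at hk
    exact ⟨(k : ℤ) - N, by rw [mem_Icc]; omega, by omega⟩
  · intro j hj
    rw [mem_Icc] at hj
    obtain ⟨k, hk⟩ : ∃ k : ℕ, (N : ℤ) + j = k := ⟨((N : ℤ) + j).toNat, by omega⟩
    obtain rfl : j = k - N := by omega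
    rw [hk, Int.toNat_natCast]
    have e1 : (h ^ 2) ^ k.choose 2 = h ^ ((k : ℤ) * (k - 1)) := by
      rw [← pow_mul, ← zpow_natCast]
      congr 1
      rcases k with _ | k
      · simp
      · have := Nat.add_one_mul_choose_eq k 1
        simp at this
        push_cast; linarith [(by exact_mod_cast this :
          ((k : ℤ) + 1) * k = ((k + 1).choose 2 : ℤ) * 2)]
    rw [e1, mul_pow, ← zpow_natCast (h ^ _) k, ← zpow_mul]
    have e2 : w ^ k = w ^ N * w ^ ((k : ℤ) - N) := by
      rw [← zpow_natCast, ← zpow_natCast, ← zpow_add₀ hw]; congr 1; ring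
    have e3 : h ^ ((k : ℤ) * (k - 1)) * h ^ ((1 - 2 * (N : ℤ)) * k) =
        h ^ (-(N : ℤ) ^ 2) * h ^ (((k : ℤ) - N) ^ 2) := by
      rw [← zpow_add₀ h0, ← zpow_add₀ h0]; congr 1; ring
    rw [e2]
    linear_combination (-gaussBinom (h ^ 2) (2 * N) k * w ^ N * w ^ ((k : ℤ) - N)) * e3

/-- The partial Euler products and their inverses both converge, hence are bounded. This uniform
bound supplies the dominating series in the limit `N → ∞`. -/
lemma exists_norm_gaussBinom_le {q : ℂ} (hq : ‖q‖ < 1) :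
    ∃ C : ℝ, ∀ n k, ‖gaussBinom q n k‖ ≤ C := by
  have h1 := tendsto_qFactorialProd hq
  have h2 := h1.inv₀ (tprod_one_sub_pow_succ_ne_zero hq)
  obtain ⟨A, hA⟩ := (Metric.isBounded_range_of_tendsto _ h1).exists_norm_le
  obtain ⟨B, hB⟩ := (Metric.isBounded_range_of_tendsto _ h2).exists_norm_le
  have hA' : ∀ n, ‖qFactorialProd q n‖ ≤ A := fun n => hA _ ⟨n, rfl⟩
  have hB' : ∀ n, ‖(qFactorialProd q n)⁻¹‖ ≤ B := fun n => hB _ ⟨n, rfl⟩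
  refine ⟨A * (B * B), fun n k => ?_⟩
  rw [gaussBinom, div_eq_mul_inv, mul_inv, norm_mul, norm_mul]
  have hA0 := (norm_nonneg _).trans (hA' 0)
  have hB0 := (norm_nonneg _).trans (hB' 0)
  gcongr
  exacts [hA' n, hB' k, hB' _]

lemma tendsto_gaussBinom_central {q : ℂ} (hq : ‖q‖ < 1) (j : ℤ) :
    Tendsto (fun N : ℕ => gaussBinom q (2 * N) (N + j).toNat) atTop
      (𝓝 (∏' n : ℕ, (1 - q ^ (n + 1)))⁻¹) := by
  have h1 := tendsto_qFactorialProd hq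
  have h0 := tprod_one_sub_pow_succ_ne_zero hq
  have t1 : Tendsto (fun N : ℕ => 2 * N) atTop atTop :=
    tendsto_atTop_mono (fun N => Nat.le_mul_of_pos_left N two_pos) tendsto_id
  have t2 : Tendsto (fun N : ℕ => ((N : ℤ) + j).toNat) atTop atTop :=
    tendsto_atTop_mono (f := fun N : ℕ => N - j.natAbs) (fun N => by omega)
      (tendsto_sub_atTop_nat _)
  have t3 : Tendsto (fun N : ℕ => 2 * N - ((N : ℤ) + j).toNat) atTop atTop :=
    tendsto_atTop_mono (f := fun N : ℕ => N - j.natAbs) (fun N => by omega)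
      (tendsto_sub_atTop_nat _)
  have := (h1.comp t1).div ((h1.comp t2).mul (h1.comp t3)) (mul_ne_zero h0 h0)
  rwa [div_mul_cancel_left₀ h0] at this

lemma norm_cexp_pi_I_mul_lt_one {τ : ℂ} (hτ : 0 < τ.im) : ‖cexp (Real.pi * I * τ)‖ < 1 := by
  rw [norm_exp, Real.exp_lt_one_iff]
  simp
  positivity

/-- The Jacobi triple product identity. -/
theorem jacobiTheta₂_eq_tprod (z : ℂ) {τ : ℂ} (hτ : 0 < τ.im) :
    jacobiTheta₂ z τ = (∏' n : ℕ, (1 - (cexp (Real.pi * I * τ) ^ 2) ^ (n + 1))) *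
      (oddProd (cexp (Real.pi * I * τ)) (cexp (2 * Real.pi * I * z)) *
        oddProd (cexp (Real.pi * I * τ)) (cexp (2 * Real.pi * I * z))⁻¹) := by
  set h := cexp (Real.pi * I * τ) with hdef
  set w := cexp (2 * Real.pi * I * z) with wdef
  have h0 : h ≠ 0 := exp_ne_zero _
  have hw : w ≠ 0 := exp_ne_zero _
  have hh : ‖h‖ < 1 := norm_cexp_pi_I_mul_lt_one hτ
  have hq : ‖h ^ 2‖ < 1 := by rw [norm_pow]; exact pow_lt_one₀ (norm_nonneg _) hh two_ne_zero
  have hterm : ∀ j : ℤ, h ^ (j ^ 2) * w ^ j = jacobiTheta₂_term j z τ := by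
    intro j
    rw [jacobiTheta₂_term, hdef, wdef, ← exp_int_mul, ← exp_int_mul, ← exp_add]
    congr 1; push_cast; ring
  have hP := (tendsto_oddProd hh w).mul (tendsto_oddProd hh w⁻¹)
  -- The finite sums, extended by zero to all of `ℤ`, converge by dominated convergence.
  have hS : Tendsto (fun N : ℕ => ∑' j : ℤ, if j ∈ Icc (-(N : ℤ)) N then
      gaussBinom (h ^ 2) (2 * N) (N + j).toNat * jacobiTheta₂_term j z τ else 0) atTop
      (𝓝 (∑' j : ℤ, (∏' n : ℕ, (1 - (h ^ 2) ^ (n + 1)))⁻¹ * jacobiTheta₂_term j z τ)) := by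
    obtain ⟨C, hC⟩ := exists_norm_gaussBinom_le hq
    have hC0 := (norm_nonneg _).trans (hC 0 0)
    refine tendsto_tsum_of_dominated_convergence
      (bound := fun j => C * ‖jacobiTheta₂_term j z τ‖)
      (((summable_jacobiTheta₂_term_iff z τ).mpr hτ).norm.mul_left C) (fun j => ?_) ?_
    · refine ((tendsto_gaussBinom_central hq j).mul_const _).congr' ?_
      filter_upwards [eventually_ge_atTop j.natAbs] with N hN
      rw [if_pos]
      rw [mem_Icc]; omega
    · refine .of_forall fun N j => ?_
      split_ifs
      · rw [norm_mul]
        gcongr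
        exact hC _ _
      · simp; positivity
  have heq : ∀ N : ℕ, (∑' j : ℤ, if j ∈ Icc (-(N : ℤ)) N then
      gaussBinom (h ^ 2) (2 * N) (N + j).toNat * jacobiTheta₂_term j z τ else 0) =
      (∏ k ∈ range N, (1 + h ^ (2 * k + 1) * w)) *
        ∏ k ∈ range N, (1 + h ^ (2 * k + 1) * w⁻¹) := by
    intro N
    rw [finite_triple_product h0 hh hw, tsum_eq_sum (s := Icc (-(N : ℤ)) N)
      fun j hj => if_neg hj]
    refine sum_congr rfl fun j hj => ?_
    rw [if_pos hj, hterm]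
  have := tendsto_nhds_unique (hS.congr heq) hP
  rw [← this, tsum_mul_left, ← mul_assoc,
    mul_inv_cancel₀ (tprod_one_sub_pow_succ_ne_zero hq), one_mul]
  rfl

end JacobiTripleProduct

/-! ### Products of three theta functions. -/

section CubicProducts

open Filter Topology Finset

/-- Euler's product `∏_{n ≥ 1} (1 - q^n)`. -/
noncomputable def eulerProd (q : ℂ) : ℂ := ∏' n : ℕ, (1 - q ^ (n + 1))

/-- Factor by factor this is `(1 + x)(1 + ωx)(1 + ω²x) = 1 + x³`. -/
lemma oddProd_mul_cubeRoots {h : ℂ} (hh : ‖h‖ < 1) (w : ℂ) {ω : ℂ} (hω : ω ^ 2 + ω + 1 = 0) :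
    oddProd h w * oddProd h (ω * w) * oddProd h (ω ^ 2 * w) = oddProd (h ^ 3) (w ^ 3) := by
  have m := multipliable_oddProd hh
  unfold oddProd
  rw [← (m w).tprod_mul (m (ω * w)), ← ((m w).mul (m (ω * w))).tprod_mul (m (ω ^ 2 * w))]
  refine tprod_congr fun n => ?_
  have hω3 : ω ^ 3 = 1 := by linear_combination (ω - 1) * hω
  have e : (h ^ 3) ^ (2 * n + 1) = (h ^ (2 * n + 1)) ^ 3 := by rw [← pow_mul, ← pow_mul, mul_comm]
  rw [e]
  generalize h ^ (2 * n + 1) = x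
  linear_combination (x * w + ω * x ^ 2 * w ^ 2) * hω + x ^ 3 * w ^ 3 * hω3

/-- The odd exponents are sorted into `6n + 1`, `6n + 3` and `6n + 5`; partial products of length
`N` on the left equal one of length `3N` on the right. -/
lemma oddProd_trisect {h : ℂ} (h0 : h ≠ 0) (hh : ‖h‖ < 1) (w : ℂ) :
    oddProd (h ^ 3) ((h ^ 2)⁻¹ * w) * oddProd (h ^ 3) w * oddProd (h ^ 3) (h ^ 2 * w) =
      oddProd h w := by
  have hh3 : ‖h ^ 3‖ < 1 := by rw [norm_pow]; exact pow_lt_one₀ (norm_nonneg _) hh three_ne_zero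
  have t := ((tendsto_oddProd hh3 ((h ^ 2)⁻¹ * w)).mul (tendsto_oddProd hh3 w)).mul
    (tendsto_oddProd hh3 (h ^ 2 * w))
  have t1 : Tendsto (fun N : ℕ => 3 * N) atTop atTop :=
    tendsto_atTop_mono (fun N => Nat.le_mul_of_pos_left N three_pos) tendsto_id
  refine tendsto_nhds_unique (t.congr fun N => ?_) ((tendsto_oddProd hh w).comp t1)
  simp only [Function.comp]
  induction N with
  | zero => simp
  | succ N ih =>
    rw [show 3 * (N + 1) = 3 * N + 1 + 1 + 1 by ring]
    simp only [prod_range_succ _ N, prod_range_succ _ (3 * N + 1 + 1), prod_range_succ _ (3 * N + 1),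
      prod_range_succ _ (3 * N)]
    rw [← ih]
    have e0 : (h ^ 3) ^ (2 * N + 1) * ((h ^ 2)⁻¹ * w) = h ^ (2 * (3 * N) + 1) * w := by
      field_simp; ring
    have e1 : (h ^ 3) ^ (2 * N + 1) * w = h ^ (2 * (3 * N + 1) + 1) * w := by ring
    have e2 : (h ^ 3) ^ (2 * N + 1) * (h ^ 2 * w) = h ^ (2 * (3 * N + 1 + 1) + 1) * w := by ring
    rw [e0, e1, e2]
    ring

lemma cubeRoot_eq : cexp (2 * Real.pi * I * (1 / 3)) ^ 2 + cexp (2 * Real.pi * I * (1 / 3)) + 1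
    = 0 := by
  have h := (Complex.isPrimitiveRoot_exp 3 three_ne_zero).geom_sum_eq_zero (by norm_num)
  simp only [sum_range_succ, sum_range_zero] at h
  rw [show 2 * (Real.pi : ℂ) * I * (1 / 3) = 2 * Real.pi * I / (3 : ℕ) by push_cast; ring]
  linear_combination h

lemma jacobiTheta₂_mul_thirds (z : ℂ) {τ : ℂ} (hτ : 0 < τ.im) :
    eulerProd ((cexp (Real.pi * I * τ) ^ 2) ^ 3) *
      (jacobiTheta₂ z τ * jacobiTheta₂ (z + 1 / 3) τ * jacobiTheta₂ (z + 2 / 3) τ) =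
    eulerProd (cexp (Real.pi * I * τ) ^ 2) ^ 3 * jacobiTheta₂ (3 * z) (3 * τ) := by
  have hτ3 : 0 < (3 * τ).im := by simpa using hτ
  have hh := norm_cexp_pi_I_mul_lt_one hτ
  rw [jacobiTheta₂_eq_tprod _ hτ, jacobiTheta₂_eq_tprod _ hτ, jacobiTheta₂_eq_tprod _ hτ,
    jacobiTheta₂_eq_tprod _ hτ3]
  have e1 : cexp (Real.pi * I * (3 * τ)) = cexp (Real.pi * I * τ) ^ 3 := by
    rw [← exp_nat_mul]; congr 1; push_cast; ring
  set h := cexp (Real.pi * I * τ)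
  set w := cexp (2 * Real.pi * I * z)
  set ω := cexp (2 * Real.pi * I * (1 / 3)) with hωdef
  have hω : ω ^ 2 + ω + 1 = 0 := cubeRoot_eq
  have hω3 : ω ^ 3 = 1 := by linear_combination (ω - 1) * hω
  have hω0 : ω ≠ 0 := exp_ne_zero _
  have e2 : cexp (2 * Real.pi * I * (z + 1 / 3)) = ω * w := by
    rw [hωdef, ← exp_add]; congr 1; ring
  have e3 : cexp (2 * Real.pi * I * (z + 2 / 3)) = ω ^ 2 * w := by
    rw [hωdef, ← exp_nat_mul, ← exp_add]; congr 1; push_cast; ring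
  have e4 : cexp (2 * Real.pi * I * (3 * z)) = w ^ 3 := by
    rw [← exp_nat_mul]; congr 1; push_cast; ring
  have e5 : (ω * w)⁻¹ = ω ^ 2 * w⁻¹ := by
    rw [mul_inv]; congr 1; field_simp; exact hω3.symm
  have e6 : (ω ^ 2 * w)⁻¹ = ω * w⁻¹ := by
    rw [mul_inv]; congr 1; field_simp; exact hω3.symm
  have p1 := oddProd_mul_cubeRoots hh w hω
  have p2 := oddProd_mul_cubeRoots hh w⁻¹ hω
  rw [e1, e2, e3, e4, e5, e6, ← inv_pow w, ← p1, ← p2, pow_right_comm h 3 2]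
  simp only [eulerProd]
  ring

lemma jacobiTheta₂_mul_shifts (z : ℂ) {τ : ℂ} (hτ : 0 < τ.im) :
    eulerProd (cexp (Real.pi * I * τ) ^ 2) *
      (jacobiTheta₂ (z - τ) (3 * τ) * jacobiTheta₂ z (3 * τ) * jacobiTheta₂ (z + τ) (3 * τ)) =
    eulerProd ((cexp (Real.pi * I * τ) ^ 2) ^ 3) ^ 3 * jacobiTheta₂ z τ := by
  have hτ3 : 0 < (3 * τ).im := by simpa using hτ
  have hh := norm_cexp_pi_I_mul_lt_one hτ
  rw [jacobiTheta₂_eq_tprod _ hτ, jacobiTheta₂_eq_tprod _ hτ3, jacobiTheta₂_eq_tprod _ hτ3,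
    jacobiTheta₂_eq_tprod _ hτ3]
  have e1 : cexp (Real.pi * I * (3 * τ)) = cexp (Real.pi * I * τ) ^ 3 := by
    rw [← exp_nat_mul]; congr 1; push_cast; ring
  have e2 : cexp (2 * Real.pi * I * (z - τ)) =
      (cexp (Real.pi * I * τ) ^ 2)⁻¹ * cexp (2 * Real.pi * I * z) := by
    rw [← exp_nat_mul, ← exp_neg, ← exp_add]; congr 1; push_cast; ring
  have e3 : cexp (2 * Real.pi * I * (z + τ)) =
      cexp (Real.pi * I * τ) ^ 2 * cexp (2 * Real.pi * I * z) := by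
    rw [← exp_nat_mul, ← exp_add]; congr 1; push_cast; ring
  have h0 : cexp (Real.pi * I * τ) ≠ 0 := exp_ne_zero _
  set h := cexp (Real.pi * I * τ)
  set w := cexp (2 * Real.pi * I * z)
  have p1 := oddProd_trisect h0 hh w
  have p2 := oddProd_trisect h0 hh w⁻¹
  rw [e1, e2, e3, mul_inv, mul_inv, inv_inv, ← p1, ← p2, pow_right_comm h 3 2]
  simp only [eulerProd]
  ring

end CubicProducts

/-! ### Constant terms of theta products by integration over a period. -/

section ConstantTerm

open MeasureTheory

lemma integral_cexp_int_mul (n : ℤ) :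
    ∫ x in (0 : ℝ)..1, cexp (2 * Real.pi * I * (n * x)) = if n = 0 then 1 else 0 := by
  split_ifs with h
  · simp [h]
  · have hc : 2 * Real.pi * I * n ≠ 0 := by
      simp [Real.pi_ne_zero, h]
    simp_rw [← mul_assoc]
    rw [integral_exp_mul_complex hc]
    have : cexp (2 * Real.pi * I * n * (1 : ℝ)) = 1 := by
      rw [exp_eq_one_iff]; exact ⟨n, by push_cast; ring⟩
    rw [this]; simp

/-- Integration over a period extracts the constant term of an absolutely convergent Fourier
series. -/
lemma integral_tsum_mul_cexp {ι : Type*} [Countable ι] {f : ι → ℂ} (hf : Summable f) (d : ι → ℤ) :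
    ∫ x in (0 : ℝ)..1, ∑' i, f i * cexp (2 * Real.pi * I * (d i * x)) =
      ∑' i, if d i = 0 then f i else 0 := by
  have hn : ∀ i (x : ℝ), ‖f i * cexp (2 * Real.pi * I * (d i * x))‖ = ‖f i‖ := fun i x => by
    rw [norm_mul, show 2 * (Real.pi : ℂ) * I * (d i * x) = ((2 * Real.pi * (d i * x) : ℝ) : ℂ) * I by
      push_cast; ring, norm_exp_ofReal_mul_I, mul_one]
  have := intervalIntegral.hasSum_integral_of_dominated_convergence (μ := volume) (a := 0) (b := 1)
    (F := fun i (x : ℝ) => f i * cexp (2 * Real.pi * I * (d i * x)))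
    (f := fun x : ℝ => ∑' i, f i * cexp (2 * Real.pi * I * (d i * x)))
    (fun i _ => ‖f i‖) (fun i => by
      refine Continuous.aestronglyMeasurable ?_
      fun_prop) (fun i => .of_forall fun x _ => (hn i x).le)
    (.of_forall fun x _ => hf.norm) (by simp) (.of_forall fun x _ => by
      refine (Summable.of_norm ?_).hasSum
      simpa only [hn] using hf.norm)
  rw [← this.tsum_eq]
  refine tsum_congr fun i => ?_
  rw [intervalIntegral.integral_const_mul, integral_cexp_int_mul]
  simp

/-- The triple of integers with sum zero and given outer entries. -/
def zeroSumTriple (p : ℤ × ℤ) : (ℤ × ℤ) × ℤ := ((p.1, -p.1 - p.2), p.2)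

lemma injective_zeroSumTriple : Function.Injective zeroSumTriple := by
  rintro ⟨a, b⟩ ⟨c, d⟩ h
  simp only [zeroSumTriple, Prod.mk.injEq] at h ⊢
  exact ⟨h.1.1, h.2⟩

lemma summable_mul_mul {f g k : ℤ → ℂ} (hf : Summable f) (hg : Summable g) (hk : Summable k) :
    Summable fun p : (ℤ × ℤ) × ℤ => f p.1.1 * g p.1.2 * k p.2 :=
  summable_mul_of_summable_norm (f := fun p : ℤ × ℤ => f p.1 * g p.2)
    (summable_mul_of_summable_norm hf.norm hg.norm).norm hk.norm

lemma summable_mul_mul_zeroSum {f g k : ℤ → ℂ} (hf : Summable f) (hg : Summable g)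
    (hk : Summable k) : Summable fun p : ℤ × ℤ => f p.1 * g (-p.1 - p.2) * k p.2 := by
  have h := (summable_mul_mul hf hg hk).comp_injective injective_zeroSumTriple
  simpa only [Function.comp_def, zeroSumTriple] using h

lemma integral_tsum_mul_tsum_mul_tsum {f g k : ℤ → ℂ} (hf : Summable f) (hg : Summable g)
    (hk : Summable k) :
    ∫ x in (0 : ℝ)..1, (∑' n, f n * cexp (2 * Real.pi * I * (n * x))) *
      (∑' n, g n * cexp (2 * Real.pi * I * (n * x))) *
      (∑' n, k n * cexp (2 * Real.pi * I * (n * x))) =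
    ∑' p : ℤ × ℤ, f p.1 * g (-p.1 - p.2) * k p.2 := by
  have hfgk := summable_mul_mul hf hg hk
  have hn : ∀ {f : ℤ → ℂ}, Summable f → ∀ x : ℝ,
      Summable fun n => ‖f n * cexp (2 * Real.pi * I * (n * x))‖ := by
    intro f hf x
    refine hf.norm.congr fun n => ?_
    rw [norm_mul, show 2 * (Real.pi : ℂ) * I * (n * x) = ((2 * Real.pi * (n * x) : ℝ) : ℂ) * I by
      push_cast; ring, norm_exp_ofReal_mul_I, mul_one]
  have hint : ∀ x : ℝ, (∑' n, f n * cexp (2 * Real.pi * I * (n * x))) *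
      (∑' n, g n * cexp (2 * Real.pi * I * (n * x))) *
      (∑' n, k n * cexp (2 * Real.pi * I * (n * x))) =
      ∑' p : (ℤ × ℤ) × ℤ, (f p.1.1 * g p.1.2 * k p.2) *
        cexp (2 * Real.pi * I * (((p.1.1 + p.1.2 + p.2 : ℤ) : ℂ) * x)) := by
    intro x
    have hs := summable_mul_of_summable_norm (hn hf x) (hn hg x)
    rw [tsum_mul_tsum_of_summable_norm (hn hf x) (hn hg x),
      tsum_mul_tsum_of_summable_norm hs.norm (hn hk x)]
    refine tsum_congr fun p => ?_
    have : cexp (2 * Real.pi * I * (((p.1.1 + p.1.2 + p.2 : ℤ) : ℂ) * x)) =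
        cexp (2 * Real.pi * I * (p.1.1 * x)) * cexp (2 * Real.pi * I * (p.1.2 * x)) *
          cexp (2 * Real.pi * I * (p.2 * x)) := by
      rw [← exp_add, ← exp_add]; congr 1; push_cast; ring
    rw [this]; ring
  simp_rw [hint]
  rw [integral_tsum_mul_cexp hfgk]
  -- The surviving terms are supported on triples with sum zero, the image of `zeroSumTriple`.
  rw [← injective_zeroSumTriple.tsum_eq]
  · refine tsum_congr fun p => if_pos ?_
    simp only [zeroSumTriple]
    ring
  · rintro ⟨⟨a, b⟩, c⟩ h
    have h0 : a + b + c = 0 := by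
      by_contra hne
      exact h (if_neg hne)
    exact ⟨(a, c), by simp only [zeroSumTriple, Prod.mk.injEq, and_true, true_and]; omega⟩

lemma jacobiTheta₂_add_eq_tsum (c : ℂ) (x : ℝ) (τ : ℂ) :
    jacobiTheta₂ (x + c) τ =
      ∑' n : ℤ, jacobiTheta₂_term n c τ * cexp (2 * Real.pi * I * (n * x)) := by
  refine tsum_congr fun n => ?_
  rw [jacobiTheta₂_term, jacobiTheta₂_term, ← exp_add]
  congr 1; ring

lemma integral_jacobiTheta₂_int_mul {τ : ℂ} (hτ : 0 < τ.im) {m : ℤ} (hm : m ≠ 0) :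
    ∫ x in (0 : ℝ)..1, jacobiTheta₂ (m * x) τ = 1 := by
  have h : ∀ x : ℝ, jacobiTheta₂ (m * x) τ =
      ∑' n : ℤ, jacobiTheta₂_term n 0 τ * cexp (2 * Real.pi * I * ((n * m : ℤ) * x)) := fun x => by
    refine tsum_congr fun n => ?_
    rw [jacobiTheta₂_term, jacobiTheta₂_term, ← exp_add]
    congr 1; push_cast; ring
  simp_rw [h]
  rw [integral_tsum_mul_cexp ((summable_jacobiTheta₂_term_iff 0 τ).mpr hτ), tsum_eq_single 0]
  · simp [jacobiTheta₂_term]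
  · intro n hn
    exact if_neg (mul_ne_zero hn hm)

lemma integral_jacobiTheta₂_mul_mul (a b c : ℂ) {τ : ℂ} (hτ : 0 < τ.im) :
    ∫ x in (0 : ℝ)..1, jacobiTheta₂ (x + a) τ * jacobiTheta₂ (x + b) τ * jacobiTheta₂ (x + c) τ =
      ∑' p : ℤ × ℤ, jacobiTheta₂_term p.1 a τ * jacobiTheta₂_term (-p.1 - p.2) b τ *
        jacobiTheta₂_term p.2 c τ := by
  have hs := fun z => (summable_jacobiTheta₂_term_iff z τ).mpr hτ
  simp_rw [jacobiTheta₂_add_eq_tsum]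
  exact integral_tsum_mul_tsum_mul_tsum (hs a) (hs b) (hs c)

/-- `∏ (1 - q^n)^3 / (1 - q^{3n})` as a sum over the `A₂` lattice. -/
lemma eulerProd_pow_three_eq_tsum {τ : ℂ} (hτ : 0 < τ.im) :
    eulerProd (cexp (Real.pi * I * τ) ^ 2) ^ 3 = eulerProd ((cexp (Real.pi * I * τ) ^ 2) ^ 3) *
      ∑' p : ℤ × ℤ, jacobiTheta₂_term p.1 0 τ * jacobiTheta₂_term (-p.1 - p.2) (1 / 3) τ *
        jacobiTheta₂_term p.2 (2 / 3) τ := by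
  have hτ3 : 0 < (3 * τ).im := by simpa using hτ
  -- The factor 1 is inserted as the constant term of the theta function that the cubic product
  -- identity produces.
  have h1 : eulerProd (cexp (Real.pi * I * τ) ^ 2) ^ 3 = eulerProd (cexp (Real.pi * I * τ) ^ 2) ^ 3 *
      ∫ x in (0 : ℝ)..1, jacobiTheta₂ ((3 : ℤ) * x) (3 * τ) := by
    rw [integral_jacobiTheta₂_int_mul hτ3 three_ne_zero, mul_one]
  rw [h1, ← integral_jacobiTheta₂_mul_mul 0 (1 / 3) (2 / 3) hτ,
    ← intervalIntegral.integral_const_mul, ← intervalIntegral.integral_const_mul]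
  refine intervalIntegral.integral_congr fun x _ => ?_
  simpa using (jacobiTheta₂_mul_thirds x hτ).symm

/-- `∏ (1 - q^{3n})^3 / (1 - q^n)` as a sum over the `A₂` lattice. -/
lemma eulerProd_cube_pow_three_eq_tsum {τ : ℂ} (hτ : 0 < τ.im) :
    eulerProd ((cexp (Real.pi * I * τ) ^ 2) ^ 3) ^ 3 = eulerProd (cexp (Real.pi * I * τ) ^ 2) *
      ∑' p : ℤ × ℤ, jacobiTheta₂_term p.1 (-τ) (3 * τ) * jacobiTheta₂_term (-p.1 - p.2) 0 (3 * τ) *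
        jacobiTheta₂_term p.2 τ (3 * τ) := by
  have hτ3 : 0 < (3 * τ).im := by simpa using hτ
  have h1 : eulerProd ((cexp (Real.pi * I * τ) ^ 2) ^ 3) ^ 3 =
      eulerProd ((cexp (Real.pi * I * τ) ^ 2) ^ 3) ^ 3 *
        ∫ x in (0 : ℝ)..1, jacobiTheta₂ ((1 : ℤ) * x) τ := by
    rw [integral_jacobiTheta₂_int_mul hτ one_ne_zero, mul_one]
  rw [h1, ← integral_jacobiTheta₂_mul_mul (-τ) 0 τ hτ3,
    ← intervalIntegral.integral_const_mul, ← intervalIntegral.integral_const_mul]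
  refine intervalIntegral.integral_congr fun x _ => ?_
  simpa [sub_eq_add_neg] using (jacobiTheta₂_mul_shifts x hτ).symm

end ConstantTerm

/-! ### Lattice sums as level 3 theta functions. -/

section LatticeSums

open A2Blowup

lemma thetaA2_lam1_eq_tsum (k : ℤ) (τ : ℂ) :
    thetaA2 (lam1 k) τ = ∑' p : ℤ × ℤ,
      cexp (2 * Real.pi * I * τ * (3 * (p.1 ^ 2 - p.1 * p.2 + p.2 ^ 2) + k * p.1 + k ^ 2 / 9)) := by
  rw [← (finTwoArrowEquiv ℤ).tsum_eq]
  refine tsum_congr fun m => ?_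
  congr 2
  have hinv : ((CartanMatrix.A 2).map (fun n : ℤ => (n : ℝ)))⁻¹ = !![2 / 3, 1 / 3; 1 / 3, 2 / 3] := by
    refine Matrix.inv_eq_right_inv ?_
    ext i j
    fin_cases i <;> fin_cases j <;> simp [CartanMatrix.A, Matrix.mul_apply] <;> norm_num
  have hv : shiftedVector (CartanMatrix.A 2) 3 (lam1 k) m =
      ![(m 0 : ℝ) + 2 * k / 9, m 1 + k / 9] := by
    rw [shiftedVector, hinv]
    ext i
    fin_cases i <;> simp [lam1, dotProduct] <;> ring
  rw [hv]
  simp [CartanMatrix.A, Matrix.mulVec, dotProduct]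
  ring

lemma lam0_eq_lam1_zero : lam0 = lam1 0 := by
  ext i; fin_cases i <;> simp [lam0, lam1]

/-- The pairs `(a, b)` of integers, parametrized by the class of `b - a` modulo `3`. -/
def diffModThreeEquiv : (ℤ × ℤ) × Fin 3 ≃ ℤ × ℤ where
  toFun x := (x.1.1 - 2 * x.1.2, x.1.1 + x.1.2 + (x.2 : ℕ))
  invFun y := ((y.1 + 2 * ((y.2 - y.1) / 3), (y.2 - y.1) / 3), ⟨((y.2 - y.1) % 3).toNat, by omega⟩)
  left_inv := by
    rintro ⟨⟨p, e⟩, r, hr⟩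
    simp only [Prod.mk.injEq, Fin.mk.injEq]
    omega
  right_inv := by
    rintro ⟨a, b⟩
    simp only [Prod.mk.injEq]
    omega

lemma tsum_eq_sum_diffModThree {f : ℤ × ℤ → ℂ} (hf : Summable f) :
    ∑' p, f p = (∑' p : ℤ × ℤ, f (p.1 - 2 * p.2, p.1 + p.2)) +
      (∑' p : ℤ × ℤ, f (p.1 - 2 * p.2, p.1 + p.2 + 1)) +
      ∑' p : ℤ × ℤ, f (p.1 - 2 * p.2, p.1 + p.2 + 2) := by
  have hs : Summable fun x => f (diffModThreeEquiv x) := diffModThreeEquiv.summable_iff.mpr hf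
  have hs' : ∀ r, Summable fun x : ℤ × ℤ => f (diffModThreeEquiv (x, r)) := fun r =>
    hs.comp_injective (i := fun x : ℤ × ℤ => (x, r)) (Prod.mk_left_injective r)
  rw [← diffModThreeEquiv.tsum_eq, hs.tsum_prod]
  simp only [tsum_fintype, Fin.sum_univ_three]
  rw [((hs' 0).add (hs' 1)).tsum_add (hs' 2), (hs' 0).tsum_add (hs' 1)]
  simp [diffModThreeEquiv]

lemma summable_jacobiTheta₂_term_mul_mul (a b c : ℂ) {τ : ℂ} (hτ : 0 < τ.im) :
    Summable fun p : ℤ × ℤ => jacobiTheta₂_term p.1 a τ * jacobiTheta₂_term (-p.1 - p.2) b τ *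
        jacobiTheta₂_term p.2 c τ := by
  have hs := fun z => (summable_jacobiTheta₂_term_iff z τ).mpr hτ
  have h := summable_mul_mul_zeroSum (hs a) (hs b) (hs c)
  exact h

/-- The affine involution `(p, e) ↦ (a - p, b - e)` of `ℤ²`. -/
def subLeftProd (a b : ℤ) : ℤ × ℤ ≃ ℤ × ℤ := (Equiv.subLeft a).prodCongr (Equiv.subLeft b)

lemma tsum_thirds_eq_candOne {τ : ℂ} (hτ : 0 < τ.im) :
    ∑' p : ℤ × ℤ, jacobiTheta₂_term p.1 0 τ * jacobiTheta₂_term (-p.1 - p.2) (1 / 3) τ *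
        jacobiTheta₂_term p.2 (2 / 3) τ = candOne τ := by
  -- For outer entries `a, b` the shifts by thirds contribute `exp(2πi(b - a)/3)`. Here `b - a = 3e
  -- + r`, so only `ω^r` remains.
  have hterm : ∀ (r : ℤ) (p e : ℤ), jacobiTheta₂_term (p - 2 * e) 0 τ *
      jacobiTheta₂_term (-(p - 2 * e) - (p + e + r)) (1 / 3) τ *
      jacobiTheta₂_term (p + e + r) (2 / 3) τ =
      cexp (2 * Real.pi * I * (1 / 3)) ^ r *
        cexp (2 * Real.pi * I * τ * (3 * (p ^ 2 - p * e + e ^ 2) + 3 * r * p + r ^ 2)) := by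
    intro r p e
    rw [jacobiTheta₂_term, jacobiTheta₂_term, jacobiTheta₂_term, ← exp_add, ← exp_add,
      ← exp_int_mul, ← exp_add, exp_eq_exp_iff_exists_int]
    exact ⟨e, by push_cast; ring⟩
  rw [tsum_eq_sum_diffModThree (summable_jacobiTheta₂_term_mul_mul _ _ _ hτ)]
  have h0 := fun p : ℤ × ℤ => hterm 0 p.1 p.2
  simp only [add_zero] at h0
  simp only [h0, fun p : ℤ × ℤ => hterm 1 p.1 p.2, fun p : ℤ × ℤ => hterm 2 p.1 p.2, tsum_mul_left]
  have t0 : ∑' p : ℤ × ℤ, cexp (2 * Real.pi * I * τ * (3 * ((p.1 : ℂ) ^ 2 - p.1 * p.2 + p.2 ^ 2) +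
      3 * ((0 : ℤ) : ℂ) * p.1 + ((0 : ℤ) : ℂ) ^ 2)) = thetaA2 lam0 τ := by
    rw [lam0_eq_lam1_zero, thetaA2_lam1_eq_tsum]
    refine tsum_congr fun p => ?_
    congr 2; push_cast; ring
  have t1 : ∑' p : ℤ × ℤ, cexp (2 * Real.pi * I * τ * (3 * ((p.1 : ℂ) ^ 2 - p.1 * p.2 + p.2 ^ 2) +
      3 * ((1 : ℤ) : ℂ) * p.1 + ((1 : ℤ) : ℂ) ^ 2)) = thetaA2 (lam1 3) τ := by
    rw [thetaA2_lam1_eq_tsum]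
    refine tsum_congr fun p => ?_
    congr 2; push_cast; ring
  have t2 : ∑' p : ℤ × ℤ, cexp (2 * Real.pi * I * τ * (3 * ((p.1 : ℂ) ^ 2 - p.1 * p.2 + p.2 ^ 2) +
      3 * ((2 : ℤ) : ℂ) * p.1 + ((2 : ℤ) : ℂ) ^ 2)) = thetaA2 (lam1 3) τ := by
    -- The class `r = 2` is the theta function of `6λ₁ ≡ -3λ₁` modulo `3M`; a point reflection
    -- identifies it with that of `3λ₁`. Then `ω + ω² = -1` gives the minus sign.
    rw [thetaA2_lam1_eq_tsum, ← (subLeftProd (-2) (-1)).tsum_eq]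
    refine tsum_congr fun p => ?_
    simp only [subLeftProd, Equiv.prodCongr_apply, Prod.map, Equiv.subLeft_apply]
    congr 2; push_cast; ring
  rw [t0, t1, t2, candOne]
  have hω := cubeRoot_eq
  generalize cexp (2 * Real.pi * I * (1 / 3)) = ω at hω ⊢
  rw [zpow_zero, zpow_one, zpow_ofNat]
  linear_combination thetaA2 (lam1 3) τ * hω

lemma tsum_shifts_eq_theta {τ : ℂ} (hτ : 0 < τ.im) :
    cexp (2 * Real.pi * I * τ * (1 / 3)) *
      ∑' p : ℤ × ℤ, jacobiTheta₂_term p.1 (-τ) (3 * τ) * jacobiTheta₂_term (-p.1 - p.2) 0 (3 * τ) *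
        jacobiTheta₂_term p.2 τ (3 * τ) =
      thetaA2 (lam1 1) (3 * τ) + thetaA2 (lam1 2) (3 * τ) + thetaA2 (lam1 4) (3 * τ) := by
  have hτ3 : 0 < (3 * τ).im := by simpa using hτ
  have hterm : ∀ (r : ℤ) (p e : ℤ), jacobiTheta₂_term (p - 2 * e) (-τ) (3 * τ) *
      jacobiTheta₂_term (-(p - 2 * e) - (p + e + r)) 0 (3 * τ) *
      jacobiTheta₂_term (p + e + r) τ (3 * τ) = (cexp (2 * Real.pi * I * τ * (1 / 3)))⁻¹ *
      cexp (2 * Real.pi * I * (3 * τ) *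
        (3 * (p ^ 2 - p * e + e ^ 2) + 3 * r * p + e + r ^ 2 + r / 3 + 1 / 9)) := by
    intro r p e
    rw [jacobiTheta₂_term, jacobiTheta₂_term, jacobiTheta₂_term, ← exp_add, ← exp_add,
      ← exp_neg, ← exp_add]
    congr 1; push_cast; ring
  rw [tsum_eq_sum_diffModThree (summable_jacobiTheta₂_term_mul_mul _ _ _ hτ3)]
  have h0 := fun p : ℤ × ℤ => hterm 0 p.1 p.2
  simp only [add_zero] at h0
  simp only [h0, fun p : ℤ × ℤ => hterm 1 p.1 p.2, fun p : ℤ × ℤ => hterm 2 p.1 p.2, tsum_mul_left,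
    ← mul_add]
  rw [mul_inv_cancel_left₀ (exp_ne_zero _), thetaA2_lam1_eq_tsum, thetaA2_lam1_eq_tsum,
    thetaA2_lam1_eq_tsum]
  -- The classes `r = 0, 1, 2` match `λ₁^1`, `λ₁^2`, `λ₁^4` through affine symmetries of the
  -- quadratic form.
  congr 1
  · congr 1
    · rw [← (Equiv.prodComm ℤ ℤ).tsum_eq]
      refine tsum_congr fun p => ?_
      simp only [Equiv.prodComm_apply, Prod.fst_swap, Prod.snd_swap]
      congr 2; push_cast; ring
    · rw [← ((Equiv.prodComm ℤ ℤ).trans (subLeftProd (-1) (-1))).tsum_eq]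
      refine tsum_congr fun p => ?_
      simp only [subLeftProd, Equiv.trans_apply, Equiv.prodComm_apply, Equiv.prodCongr_apply,
        Prod.map, Equiv.subLeft_apply, Prod.fst_swap, Prod.snd_swap]
      congr 2; push_cast; ring
  · rw [← ((Equiv.prodComm ℤ ℤ).trans
      ((Equiv.refl ℤ).prodCongr (Equiv.subRight (-1)))).symm.tsum_eq]
    refine tsum_congr fun p => ?_
    simp only [Equiv.symm_trans_apply, Equiv.prodComm_symm, Equiv.prodCongr_symm, Equiv.refl_symm,
      Equiv.prodCongr_apply, Prod.map, Equiv.refl_apply, Equiv.subRight_symm_apply,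
      Equiv.prodComm_apply, Prod.fst_swap, Prod.snd_swap]
    congr 2; push_cast; ring

end LatticeSums

/-! ### Eta quotients and translation of `τ`. -/

section EtaQuotients

open A2Blowup ModularForm

lemma eta_eq_cexp_mul_eulerProd (τ : ℂ) :
    η τ = cexp (2 * Real.pi * I * τ / 24) * eulerProd (cexp (Real.pi * I * τ) ^ 2) := by
  rw [ModularForm.eta, Function.Periodic.qParam, eulerProd]
  simp only [eta_q_eq_pow]
  rw [← exp_nat_mul]
  congr 3
  push_cast
  ring_nf

lemma zeta_pow_eq_cexp (n k : ℕ) : zeta n ^ k = cexp (2 * Real.pi * I * k / n) := by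
  rw [zeta, ← exp_nat_mul]
  congr 1; ring

lemma zeta_ne_zero (n : ℕ) : zeta n ≠ 0 := exp_ne_zero _

lemma eta_add_natCast (τ : ℂ) (b : ℕ) : η (τ + b) = zeta 24 ^ b * η τ := by
  have h : cexp (Real.pi * I * (τ + b)) ^ 2 = cexp (Real.pi * I * τ) ^ 2 := by
    rw [← exp_nat_mul, ← exp_nat_mul, exp_eq_exp_iff_exists_int]
    exact ⟨b, by push_cast; ring⟩
  rw [eta_eq_cexp_mul_eulerProd, eta_eq_cexp_mul_eulerProd, h, zeta_pow_eq_cexp, ← mul_assoc,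
    ← exp_add]
  congr 2; push_cast; ring

lemma Theta_three_one_zero (τ : ℂ) : Theta 3 1 0 τ = η τ ^ 3 / η (3 * τ) := by
  simp [Theta]

lemma Theta_one_three (b : ℕ) (τ : ℂ) : Theta 1 3 b τ = η τ ^ 3 / η ((τ + b) / 3) := by
  simp [Theta]

lemma Theta_three_one_zero_eq_candOne {τ : ℂ} (hτ : 0 < τ.im) : Theta 3 1 0 τ = candOne τ := by
  have hτ3 : 0 < (3 * τ).im := by simpa using hτ
  rw [Theta_three_one_zero, div_eq_iff (eta_ne_zero hτ3), eta_eq_cexp_mul_eulerProd,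
    eta_eq_cexp_mul_eulerProd, mul_pow, eulerProd_pow_three_eq_tsum hτ, tsum_thirds_eq_candOne hτ]
  have e1 : cexp (2 * Real.pi * I * τ / 24) ^ 3 = cexp (2 * Real.pi * I * (3 * τ) / 24) := by
    rw [← exp_nat_mul]; congr 1; push_cast; ring
  have e2 : (cexp (Real.pi * I * τ) ^ 2) ^ 3 = cexp (Real.pi * I * (3 * τ)) ^ 2 := by
    rw [← exp_nat_mul, ← exp_nat_mul, ← exp_nat_mul]; congr 1; push_cast; ring
  rw [e1, e2]
  ring

lemma candThree_zero (τ : ℂ) :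
    candThree 0 τ = thetaA2 (lam1 1) τ + thetaA2 (lam1 2) τ + thetaA2 (lam1 4) τ := by
  simp [candThree]

lemma Theta_one_three_zero_eq_candThree {τ : ℂ} (hτ : 0 < τ.im) :
    Theta 1 3 0 τ = candThree 0 τ := by
  obtain ⟨σ, rfl⟩ : ∃ σ, τ = 3 * σ := ⟨τ / 3, by ring⟩
  have hσ : 0 < σ.im := by simpa using hτ
  have hdiv : (3 * σ + (0 : ℕ)) / 3 = σ := by push_cast; ring
  rw [Theta_one_three, hdiv, div_eq_iff (eta_ne_zero hσ), candThree_zero,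
    ← tsum_shifts_eq_theta hσ, eta_eq_cexp_mul_eulerProd, eta_eq_cexp_mul_eulerProd σ, mul_pow]
  -- The prefactor of the lattice sum is the leading power of the eta quotient: `9/24 - 1/24 = 1/3`.
  have e1 : cexp (2 * Real.pi * I * (3 * σ) / 24) ^ 3 =
      cexp (2 * Real.pi * I * σ * (1 / 3)) * cexp (2 * Real.pi * I * σ / 24) := by
    rw [← exp_nat_mul, ← exp_add]; congr 1; push_cast; ring
  have e2 : cexp (Real.pi * I * (3 * σ)) ^ 2 = (cexp (Real.pi * I * σ) ^ 2) ^ 3 := by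
    rw [← exp_nat_mul, ← exp_nat_mul, ← exp_nat_mul]; congr 1; push_cast; ring
  rw [e1, e2, eulerProd_cube_pow_three_eq_tsum hσ]
  ring

lemma Theta_one_three_eq_shift (b : ℕ) (τ : ℂ) :
    Theta 1 3 b τ = zeta 24 ^ (-3 * (b : ℤ)) * Theta 1 3 0 (τ + b) := by
  have h : zeta 24 ^ (-3 * (b : ℤ)) * (zeta 24 ^ b) ^ 3 = 1 := by
    rw [← pow_mul, ← zpow_natCast, ← zpow_add₀ (zeta_ne_zero 24)]
    push_cast
    rw [show -3 * (b : ℤ) + b * 3 = 0 by ring, zpow_zero]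
  rw [Theta_one_three, Theta_one_three, eta_add_natCast, Nat.cast_zero, add_zero, mul_pow,
    mul_div_assoc, ← mul_assoc, h, one_mul]

/-- All exponents lie in `k²/9 + ℤ`. -/
lemma thetaA2_lam1_add_natCast (k b : ℕ) (τ : ℂ) :
    thetaA2 (lam1 k) (τ + b) = zeta 9 ^ (k ^ 2 * b) * thetaA2 (lam1 k) τ := by
  rw [thetaA2_lam1_eq_tsum, thetaA2_lam1_eq_tsum, ← tsum_mul_left]
  refine tsum_congr fun p => ?_
  rw [zeta_pow_eq_cexp, ← exp_add, exp_eq_exp_iff_exists_int]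
  exact ⟨b * (3 * (p.1 ^ 2 - p.1 * p.2 + p.2 ^ 2) + k * p.1), by push_cast; ring⟩

lemma zeta_three_pow (k : ℕ) : zeta 3 ^ k = zeta 9 ^ (3 * k) := by
  rw [zeta_pow_eq_cexp, zeta_pow_eq_cexp]
  congr 1; push_cast; ring

lemma zeta_nine_pow_nine : zeta 9 ^ 9 = 1 := by
  rw [zeta_pow_eq_cexp, exp_eq_one_iff]
  exact ⟨1, by push_cast; ring⟩

lemma candThree_eq_sum (b : ℕ) (τ : ℂ) :
    candThree b τ = zeta 24 ^ (-3 * (b : ℤ)) * zeta 9 ^ b * thetaA2 (lam1 1) τ +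
      zeta 24 ^ (-3 * (b : ℤ)) * zeta 9 ^ (4 * b) * thetaA2 (lam1 2) τ +
      zeta 24 ^ (-3 * (b : ℤ)) * zeta 9 ^ (7 * b) * thetaA2 (lam1 4) τ := by
  rw [candThree, zeta_three_pow, zeta_three_pow]
  ring

lemma candThree_eq_shift (b : ℕ) (τ : ℂ) :
    candThree b τ = zeta 24 ^ (-3 * (b : ℤ)) * candThree 0 (τ + b) := by
  have h1 := thetaA2_lam1_add_natCast 1 b τ
  have h2 := thetaA2_lam1_add_natCast 2 b τ
  have h4 := thetaA2_lam1_add_natCast 4 b τ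
  have h9 : zeta 9 ^ (4 ^ 2 * b) = zeta 9 ^ (7 * b) := by
    rw [show 4 ^ 2 * b = 9 * b + 7 * b by ring, pow_add, pow_mul, zeta_nine_pow_nine, one_pow,
      one_mul]
  rw [h9] at h4
  push_cast at h1 h2 h4
  rw [candThree_zero, h1, h2, h4, candThree_eq_sum]
  ring

lemma Theta_one_three_eq_candThree (b : ℕ) {τ : ℂ} (hτ : 0 < τ.im) :
    Theta 1 3 b τ = candThree b τ := by
  rw [Theta_one_three_eq_shift, candThree_eq_shift, Theta_one_three_zero_eq_candThree]
  simpa using hτ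

end EtaQuotients

/-! ### The transformation `τ ↦ -1/τ`. -/

section Inversion

open A2Blowup ModularForm

lemma eta_neg_one_div {τ : ℂ} (hτ : 0 < τ.im) :
    η (-1 / τ) = (sqrt I)⁻¹ * (sqrt τ * η τ) := by
  simpa using eta_comp_eq_csqrt_I_inv hτ

lemma csqrt_sq {z : ℂ} (hz : z ≠ 0) : sqrt z ^ 2 = z := by
  rw [sqrt_eq_exp hz, ← exp_nat_mul]
  push_cast
  rw [mul_div_cancel₀ _ two_ne_zero, exp_log hz]

lemma csqrt_ne_zero {z : ℂ} (hz : z ≠ 0) : sqrt z ≠ 0 := fun h => hz <| by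
  rw [← csqrt_sq hz, h]; simp

lemma csqrt_I : sqrt I = zeta 24 ^ 3 := by
  rw [sqrt_eq_exp I_ne_zero, log_I, zeta_pow_eq_cexp]
  congr 1; push_cast; ring

lemma csqrt_ofReal_mul {r : ℝ} (hr : 0 < r) {z : ℂ} (hz : z ≠ 0) :
    sqrt (r * z) = Real.sqrt r * sqrt z := by
  have hr' : (r : ℂ) ≠ 0 := by exact_mod_cast hr.ne'
  rw [sqrt_eq_exp (mul_ne_zero hr' hz), sqrt_eq_exp hz, log_ofReal_mul hr hz, add_div, exp_add]
  have h : Real.exp (Real.log r / 2) = Real.sqrt r := by rw [Real.exp_half, Real.exp_log hr]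
  rw [← h]
  push_cast
  rfl

lemma csqrt_re_pos_and_im_pos {z : ℂ} (hz : 0 < z.im) : 0 < (sqrt z).re ∧ 0 < (sqrt z).im := by
  have h0 : z ≠ 0 := by rintro rfl; simp at hz
  have him : (log z / 2).im = arg z / 2 := by
    rw [show log z / 2 = log z / ((2 : ℝ) : ℂ) by push_cast; rfl, div_ofReal_im, log_im]
  have h1 : 0 < arg z := lt_of_le_of_ne (arg_nonneg_iff.mpr hz.le) fun h => by
    have := (arg_eq_zero_iff.mp h.symm).2
    exact hz.ne' this
  have h2 := arg_le_pi z
  have h3 : arg z ≠ Real.pi := fun h => hz.ne' (arg_eq_pi_iff.mp h).2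
  have h4 := lt_of_le_of_ne h2 h3
  rw [sqrt_eq_exp h0, exp_re, exp_im, him]
  exact ⟨mul_pos (Real.exp_pos _) (Real.cos_pos_of_mem_Ioo ⟨by linarith, by linarith⟩),
    mul_pos (Real.exp_pos _) (Real.sin_pos_of_pos_of_lt_pi (by linarith) (by linarith))⟩

/-- The squares agree, so only the sign is in question. Square roots of points of the upper half
plane lie in the open first quadrant, so both sides have positive imaginary part. -/
lemma csqrt_mul_csqrt {u v τ : ℂ} (hu : 0 < u.im) (hv : 0 < v.im) (hτ : 0 < τ.im)
    (h : u * v = -τ) : sqrt u * sqrt v = I * sqrt τ := by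
  have hne : ∀ {z : ℂ}, 0 < z.im → z ≠ 0 := by rintro z hz rfl; simp at hz
  have hsq : (sqrt u * sqrt v) ^ 2 = (I * sqrt τ) ^ 2 := by
    rw [mul_pow, mul_pow, csqrt_sq (hne hu), csqrt_sq (hne hv), csqrt_sq (hne hτ), h, I_sq]
    ring
  rcases sq_eq_sq_iff_eq_or_eq_neg.mp hsq with h' | h'
  · exact h'
  · exfalso
    obtain ⟨a1, a2⟩ := csqrt_re_pos_and_im_pos hu
    obtain ⟨b1, b2⟩ := csqrt_re_pos_and_im_pos hv
    obtain ⟨c1, c2⟩ := csqrt_re_pos_and_im_pos hτ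
    have := congrArg im h'
    simp only [mul_im, neg_im, I_re, I_im, zero_mul, one_mul, zero_add] at this
    nlinarith [mul_pos a1 b2, mul_pos a2 b1]

lemma neg_one_div_im_pos {τ : ℂ} (hτ : 0 < τ.im) : 0 < (-1 / τ).im := by
  have h0 : τ ≠ 0 := by rintro rfl; simp at hτ
  rw [neg_div, one_div, neg_im, inv_im, neg_div, neg_neg]
  exact div_pos hτ (normSq_pos.mpr h0)

lemma Theta_three_one_zero_inversion {τ : ℂ} (hτ : 0 < τ.im) :
    Theta 3 1 0 (-1 / τ) = (-I * τ) * (Real.sqrt 3 : ℂ) * Theta 1 3 0 τ := by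
  have h0 : τ ≠ 0 := by rintro rfl; simp at hτ
  have hτ3 : 0 < (τ / 3).im := by
    rw [show τ / 3 = τ / ((3 : ℝ) : ℂ) by push_cast; rfl, div_ofReal_im]; positivity
  have h03 : τ / 3 ≠ 0 := div_ne_zero h0 three_ne_zero
  have hs : sqrt τ = Real.sqrt 3 * sqrt (τ / 3) := by
    rw [← csqrt_ofReal_mul three_pos h03]; congr 1; push_cast; ring
  have h1 := csqrt_sq h0
  have hI := csqrt_sq I_ne_zero
  have hI0 := csqrt_ne_zero I_ne_zero
  have hs0 := csqrt_ne_zero h03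
  have he0 := eta_ne_zero hτ3
  rw [Theta_three_one_zero, Theta_one_three, Nat.cast_zero, add_zero,
    show 3 * (-1 / τ) = -1 / (τ / 3) by field_simp, eta_neg_one_div hτ, eta_neg_one_div hτ3]
  have hI' : (sqrt I)⁻¹ ^ 2 = -I := by rw [inv_pow, hI, inv_I]
  rw [div_eq_iff (mul_ne_zero (inv_ne_zero hI0) (mul_ne_zero hs0 he0)), mul_pow, mul_pow]
  have key : sqrt τ ^ 3 = τ * (Real.sqrt 3 * sqrt (τ / 3)) := by
    rw [← hs, pow_succ, h1]
  rw [key, pow_succ _ 2, hI']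
  field_simp

/-- The point `(τ + 2)/3` is carried to `(-1/τ + 1)/3` by translating by `-1`, inverting,
translating by `-3` and inverting. The translations account for `ζ_24^{1+3}`; the inversions give
`(√i)⁻² √u √v = -i · i√τ = √τ`. -/
lemma eta_order_three {τ : ℂ} (hτ : 0 < τ.im) :
    zeta 24 ^ 4 * η ((-1 / τ + 1) / 3) = sqrt τ * η ((τ + 2) / 3) := by
  have h0 : τ ≠ 0 := by rintro rfl; simp at hτ
  set u : ℂ := (τ - 1) / 3 with hu
  have huim : 0 < u.im := by
    rw [hu, show (τ - 1) / 3 = (τ - 1) / ((3 : ℝ) : ℂ) by push_cast; rfl, div_ofReal_im]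
    simpa using hτ
  have hu0 : u ≠ 0 := by rintro h; rw [h] at huim; simp at huim
  set v : ℂ := -1 / u - 3 with hv
  have hvim : 0 < v.im := by
    have := neg_one_div_im_pos huim
    simpa [hv] using this
  have hv0 : v ≠ 0 := by rintro h; rw [h] at hvim; simp at hvim
  have huv : u * v = -τ := by rw [hv]; field_simp; rw [hu]; ring
  have hz : (-1 / τ + 1) / 3 = -1 / v := by
    have : τ = -(u * v) := by rw [huv, neg_neg]
    have h3 : u * v = -1 - 3 * u := by rw [hv]; field_simp
    rw [this]
    field_simp
    linear_combination h3
  have e1 : η (-1 / u) = zeta 24 ^ 3 * η v := by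
    rw [← eta_add_natCast, hv]; congr 1; push_cast; ring
  have e2 : η ((τ + 2) / 3) = zeta 24 ^ 1 * η u := by
    rw [← eta_add_natCast, hu]; congr 1; push_cast; ring
  rw [eta_neg_one_div huim] at e1
  have hI' : (sqrt I)⁻¹ ^ 2 = -I := by rw [inv_pow, csqrt_sq I_ne_zero, inv_I]
  have hs := csqrt_mul_csqrt huim hvim hτ huv
  rw [hz, eta_neg_one_div hvim, e2]
  linear_combination (-(sqrt I)⁻¹ * sqrt v * zeta 24) * e1 +
    (sqrt u * sqrt v * η u * zeta 24) * hI' + (-I * η u * zeta 24) * hs -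
    zeta 24 * η u * sqrt τ * I_sq

lemma Theta_one_three_one_inversion {τ : ℂ} (hτ : 0 < τ.im) :
    Theta 1 3 1 (-1 / τ) = (-I * τ) * zeta 24 * Theta 1 3 2 τ := by
  have h0 : τ ≠ 0 := by rintro rfl; simp at hτ
  have hdiv : ∀ {z : ℂ}, 0 < z.im → 0 < (z / 3).im := fun {z} hz => by
    rw [show z / 3 = z / ((3 : ℝ) : ℂ) by push_cast; rfl, div_ofReal_im]; positivity
  have hw : η ((τ + 2) / 3) ≠ 0 := eta_ne_zero (hdiv (z := τ + 2) (by simpa using hτ))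
  have hz : η ((-1 / τ + 1) / 3) ≠ 0 :=
    eta_ne_zero (hdiv (z := -1 / τ + 1) (by simpa using neg_one_div_im_pos hτ))
  have key := eta_order_three hτ
  have h1 := csqrt_sq h0
  have hζ := zeta_ne_zero 24
  -- With `i = ζ_24^6` the constants reduce to `ζ_24^{-9} ζ_24^4 = -i ζ_24`, that is, to `ζ_24^12 =
  -- -1`.
  have hI : zeta 24 ^ 6 = I := by
    rw [show zeta 24 ^ 6 = (zeta 24 ^ 3) ^ 2 by ring, ← csqrt_I, csqrt_sq I_ne_zero]
  have hI4 : zeta 24 ^ 12 = -1 := by rw [show zeta 24 ^ 12 = (zeta 24 ^ 6) ^ 2 by ring, hI, I_sq]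
  rw [Theta_one_three, Theta_one_three, Nat.cast_one, Nat.cast_ofNat, eta_neg_one_div hτ, csqrt_I,
    mul_div_assoc', div_eq_div_iff hz hw, ← hI, mul_pow, mul_pow, inv_pow]
  generalize η ((-1 / τ + 1) / 3) = A at *
  generalize η ((τ + 2) / 3) = B at *
  field_simp
  linear_combination (-sqrt τ ^ 2 * η τ ^ 3) * key + zeta 24 ^ 4 * η τ ^ 3 * A * τ * hI4 +
    zeta 24 ^ 4 * η τ ^ 3 * A * h1

end Inversion

/-! ### Expansions over the classes of `M*/3M`. -/

section ClassExpansion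

open A2Blowup

lemma thetaA2Class_mk (β : Fin 2 → ℤ) (τ : ℂ) :
    thetaA2Class (Submodule.Quotient.mk β) τ = thetaA2 β τ := rfl

/-- Keeps the classes of `λ₁^1, λ₁^2, λ₁^4` apart, so that each can carry its own exponent of `ζ_9`.
-/
lemma mk_lam1_ne {j k : ℤ} (h : ¬ 9 ∣ j - k) :
    (Submodule.Quotient.mk (lam1 j) : (Fin 2 → ℤ) ⧸ threeRootLattice) ≠
      Submodule.Quotient.mk (lam1 k) := by
  intro he
  obtain ⟨x, hx⟩ := (Submodule.Quotient.eq _).mp he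
  have h0 := congrFun hx 0
  have h1 := congrFun hx 1
  simp [CartanMatrix.A, lam1] at h0 h1
  omega

lemma exists_Theta_three_one_expansion :
    ∃ (n : ((Fin 2 → ℤ) ⧸ threeRootLattice) →₀ ℤ)
      (k₁ k₂ : ((Fin 2 → ℤ) ⧸ threeRootLattice) → ℤ),
      ∀ τ : ℂ, 0 < τ.im → Theta 3 1 0 τ =
        n.sum fun β c => (c : ℂ) * zeta 24 ^ k₁ β * zeta 9 ^ k₂ β * thetaA2Class β τ := by
  refine ⟨Finsupp.single (Submodule.Quotient.mk lam0) 1 +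
    Finsupp.single (Submodule.Quotient.mk (lam1 3)) (-1), fun _ => 0, fun _ => 0, fun τ hτ => ?_⟩
  rw [Theta_three_one_zero_eq_candOne hτ, Finsupp.sum_add_index' (by simp)
    (fun β c d => by push_cast; ring), Finsupp.sum_single_index (by simp),
    Finsupp.sum_single_index (by simp), thetaA2Class_mk, thetaA2Class_mk, candOne]
  push_cast
  simp only [zpow_zero]
  ring

lemma exists_Theta_one_three_expansion (b : ℕ) :
    ∃ (n : ((Fin 2 → ℤ) ⧸ threeRootLattice) →₀ ℤ)
      (k₁ k₂ : ((Fin 2 → ℤ) ⧸ threeRootLattice) → ℤ),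
      ∀ τ : ℂ, 0 < τ.im → Theta 1 3 b τ =
        n.sum fun β c => (c : ℂ) * zeta 24 ^ k₁ β * zeta 9 ^ k₂ β * thetaA2Class β τ := by
  classical
  set c : ℤ → (Fin 2 → ℤ) ⧸ threeRootLattice := fun k => Submodule.Quotient.mk (lam1 k)
  have h21 : c 2 ≠ c 1 := mk_lam1_ne (by norm_num)
  have h41 : c 4 ≠ c 1 := mk_lam1_ne (by norm_num)
  have h42 : c 4 ≠ c 2 := mk_lam1_ne (by norm_num)
  -- Since `ζ_3 = ζ_9^3`, the exponents of `ζ_9` are `b`, `b + 3b` and `b + 6b`. The value `7b` is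
  -- also the default on classes with coefficient zero, where it has no effect.
  refine ⟨Finsupp.single (c 1) 1 + Finsupp.single (c 2) 1 + Finsupp.single (c 4) 1,
    fun _ => -3 * (b : ℤ),
    fun β => if β = c 1 then (b : ℤ) else if β = c 2 then 4 * b else 7 * b, fun τ hτ => ?_⟩
  rw [Theta_one_three_eq_candThree b hτ, Finsupp.sum_add_index' (by simp)
    (fun β c d => by push_cast; ring), Finsupp.sum_add_index' (by simp)
    (fun β c d => by push_cast; ring), Finsupp.sum_single_index (by simp),
    Finsupp.sum_single_index (by simp), Finsupp.sum_single_index (by simp)]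
  simp only [if_true, if_neg h21, if_neg h41, if_neg h42]
  rw [thetaA2Class_mk, thetaA2Class_mk, thetaA2Class_mk, candThree_eq_sum]
  simp only [← zpow_natCast]
  push_cast
  ring

end ClassExpansion

theorem mainTheorem1 :
    -- the two families of identities
    (∀ τ : ℂ, 0 < τ.im → A2Blowup.Theta 3 1 0 τ = A2Blowup.candOne τ) ∧
    (∀ b : ℕ, b < 3 → ∀ τ : ℂ, 0 < τ.im → A2Blowup.Theta 1 3 b τ = A2Blowup.candThree b τ) ∧
    -- the transformation of the theta combinations under `τ ↦ -1/τ`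
    (∀ τ : ℂ, 0 < τ.im → A2Blowup.candOne (-1 / τ) =
      (-Complex.I * τ) * (Real.sqrt 3 : ℂ) * A2Blowup.candThree 0 τ) ∧
    (∀ τ : ℂ, 0 < τ.im → A2Blowup.candThree 1 (-1 / τ) =
      (-Complex.I * τ) * A2Blowup.zeta 24 * A2Blowup.candThree 2 τ) ∧
    -- the same transformation of the eta quotients
    (∀ τ : ℂ, 0 < τ.im → A2Blowup.Theta 3 1 0 (-1 / τ) =
      (-Complex.I * τ) * (Real.sqrt 3 : ℂ) * A2Blowup.Theta 1 3 0 τ) ∧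
    (∀ τ : ℂ, 0 < τ.im → A2Blowup.Theta 1 3 1 (-1 / τ) =
      (-Complex.I * τ) * A2Blowup.zeta 24 * A2Blowup.Theta 1 3 2 τ) ∧
    -- every eta quotient is a combination, over `M*/3M`, of level 3 theta functions
    -- with coefficients integers times roots of unity
    (∀ a d b : ℕ, a * d = 3 → b < d →
      ∃ (n : ((Fin 2 → ℤ) ⧸ A2Blowup.threeRootLattice) →₀ ℤ)
        (k₁ k₂ : ((Fin 2 → ℤ) ⧸ A2Blowup.threeRootLattice) → ℤ),
        ∀ τ : ℂ, 0 < τ.im → A2Blowup.Theta a d b τ =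
          n.sum fun β c => (c : ℂ) * A2Blowup.zeta 24 ^ k₁ β * A2Blowup.zeta 9 ^ k₂ β *
            A2Blowup.thetaA2Class β τ) := by
  refine ⟨fun τ hτ => Theta_three_one_zero_eq_candOne hτ,
    fun b _ τ hτ => Theta_one_three_eq_candThree b hτ, fun τ hτ => ?_, fun τ hτ => ?_,
    fun τ hτ => Theta_three_one_zero_inversion hτ, fun τ hτ => Theta_one_three_one_inversion hτ,
    fun a d b had hbd => ?_⟩
  · rw [← Theta_three_one_zero_eq_candOne (neg_one_div_im_pos hτ),
      ← Theta_one_three_eq_candThree 0 hτ]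
    exact Theta_three_one_zero_inversion hτ
  · rw [← Theta_one_three_eq_candThree 1 (neg_one_div_im_pos hτ),
      ← Theta_one_three_eq_candThree 2 hτ]
    exact Theta_one_three_one_inversion hτ
  · have ha : a ∣ 3 := ⟨d, had.symm⟩
    rcases (Nat.dvd_prime Nat.prime_three).mp ha with rfl | rfl
    · obtain rfl : d = 3 := by omega
      exact exists_Theta_one_three_expansion b
    · obtain rfl : d = 1 := by omega
      obtain rfl : b = 0 := by omega
      exact exists_Theta_three_one_expansion
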